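/- Let $\Sigma\subset\mathbb{R}^3$ be a compact smooth ($C^\infty$) embedded surface without boundary, let $\bar\rho\ge 1$ and $\alpha>0$ (in practice $\alpha=4/3$), let $\bar h:\mathbb{R}^3\to\mathbb{R}$ be continuous (for example Lipschitz) with $\bar h\ge\bar h_0$ for some $\bar h_0>0$, and let $\bar\epsilon$ be a function with $\bar\epsilon(\mathbf{x})\ge\bar\epsilon_0$ on $\Sigma$ for some $\bar\epsilon_0>0$. For a finite set $X\subset\Sigma$, the restricted Delaunay surface triangulation $\mathrm{Del}|_\Sigma(X)$ has as its facets the triangles $f$ with vertices in $X$ whose dual Voronoi edge $\mathbf{v}_f$ (the set of points that have all three vertices of $f$ among their nearest points of $X$) meets $\Sigma$. For such $f$ let $R$ be its circumradius and $\mathbf{e}_0$ a shortest edge, and put $\rho(f)=R/\|\mathbf{e}_0\|$. Let $\mathbf{x}_f\in\mathbf{v}_f\cap\Sigma$ be a centre of a largest surface Delaunay ball of $f$, that is, a point of $\mathbf{v}_f\cap\Sigma$ whose distance $r$ to the vertices of $f$ is maximal; put $h(f)=\sqrt3\,r$, and let $\epsilon(f)$ be the distance from $\mathbf{x}_f$ to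 the circumcentre of $f$. The facet $f$ is bad if, for some such $\mathbf{x}_f$, $\rho(f)\ge\bar\rho$ or $h(f)\ge\alpha\bar h(\mathbf{x}_f)$ or $\epsilon(f)\ge\bar\epsilon(\mathbf{x}_f)$. The Frontal-Delaunay algorithm starts from a finite sample $X_0\subset\Sigma$. While there are bad facets, it takes one of them (in any order, for instance giving priority to facets whose edge $\mathbf{e}_0$ is shared with a facet that is not bad), with a centre $\mathbf{x}_f$ for which it is bad, and inserts into $X$ the following refinement point. Let $\mathbf{e}_0=[\mathbf{u},\mathbf{v}]$ be a shortest edge of $f$, with midpoint $\mathbf{m}_0$. For a point $\mathbf{x}$ put $\bar h_\sigma(\mathbf{x})=\tfrac12\big(\bar h(\tfrac{\mathbf{u}+\mathbf{x}}2)+\bar h(\tfrac{\mathbf{v}+\mathbf{x}}2)\big)$ and $a_\sigma(\mathbf{x})=\min\big((\bar h_\sigma(\mathbf{x})^2-\tfrac14\|\mathbf{e}_0\|^2)^{1/2},\tfrac{\sqrt3}2\bar h_\sigma(\mathbf{x})\big)$. A Type II vertex is a point $\mathbf{x}$ of $\Sigma$ on the Voronoi face of $X$ dual to $\mathbf{e}_0$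 with $\bar h_\sigma(\mathbf{x})\ge\tfrac12\|\mathbf{e}_0\|$ and $\|\mathbf{x}-\mathbf{m}_0\|=a_\sigma(\mathbf{x})$ that maximises $(\mathbf{x}-\mathbf{m}_0)\cdot(\mathbf{x}_f-\mathbf{m}_0)$ among all such points. If there is one, one such $\mathbf{x}$ is chosen, and the refinement point is $\mathbf{x}$ if $\tfrac12\|\mathbf{e}_0\|\le\|\mathbf{x}-\mathbf{m}_0\|\le\|\mathbf{x}_f-\mathbf{m}_0\|$; in all other cases it is the Type I vertex $\mathbf{x}_f$. Then every run of the algorithm terminates after finitely many steps. It halts only when no bad facet is left, at a finite set $X\subset\Sigma$, and every facet $f$ of the resulting surface triangulation $\mathrm{Del}|_\Sigma(X)$ satisfies $\rho(f)<\bar\rho$, and, for every choice of $\mathbf{x}_f$ (there is at least one), $h(f)<\alpha\,\bar h(\mathbf{x}_f)$ and $\epsilon(f)<\bar\epsilon(\mathbf{x}_f)$. -/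

import Mathlib

noncomputable section

namespace FrontalDelaunay

open scoped ContDiff

/-- Euclidean three-space. -/
abbrev E3 : Type := EuclideanSpace ℝ (Fin 3)

/-- A smooth closed surface embedded in `ℝ³`: a compact set that is, near each of its points, a
regular level set of a `C^∞` function. It may have several connected components. -/
structure IsSmoothClosedSurface (S : Set E3) : Prop where
  isCompact : IsCompact S
  locally_regular : ∀ p ∈ S, ∃ (U : Set E3) (F : E3 → ℝ), IsOpen U ∧ p ∈ U ∧
    ContDiffOn ℝ ∞ F U ∧ fderiv ℝ F p ≠ 0 ∧ S ∩ U = {x ∈ U | F x = 0}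

/-! ### Voronoi faces and (restricted) Delaunay facets -/

/-- The (closed) face of the Voronoi diagram of `X` dual to the set of sites `A ⊆ X`: the points
for which every element of `A` is a nearest site. -/
def voronoiFace (X A : Set E3) : Set E3 :=
  {x | ∀ a ∈ A, ∀ y ∈ X, dist x a ≤ dist x y}

/-- The Voronoi edge `v_f` dual to the triangle `f`. -/
def voronoiEdge (X : Set E3) (f : Affine.Triangle ℝ E3) : Set E3 :=
  voronoiFace X (Set.range f.points)

/-- The 2-faces of the Delaunay tessellation of `X`: triangles on sites of `X` whose dual Voronoi
face is non-empty (there is an empty circumscribing ball). Triangles that differ by the numbering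
of their vertices stand for the same facet. -/
def delaunayFacets (X : Set E3) : Set (Affine.Triangle ℝ E3) :=
  {f | Set.range f.points ⊆ X ∧ (voronoiEdge X f).Nonempty}

/-- The facets of the restricted Delaunay surface triangulation `Del|_S(X)`: the Delaunay 2-faces
whose dual Voronoi edge meets the surface `S`. -/
def restrictedFacets (S X : Set E3) : Set (Affine.Triangle ℝ E3) :=
  {f ∈ delaunayFacets X | (voronoiEdge X f ∩ S).Nonempty}

/-! ### Quantities attached to a facet -/

/-- Length of the shortest edge of a triangle. -/
def minEdge (f : Affine.Triangle ℝ E3) : ℝ :=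
  min (dist (f.points 0) (f.points 1))
    (min (dist (f.points 1) (f.points 2)) (dist (f.points 2) (f.points 0)))

/-- The radius-edge ratio `ρ(f)`: radius of the diametric ball over the shortest edge length. -/
def radiusEdgeRatio (f : Affine.Triangle ℝ E3) : ℝ :=
  f.circumradius / minEdge f

/-- The radius of the ball that is centred at the point `c` of the dual Voronoi edge of `f` and
circumscribes `f` (all vertices of `f` are equidistant from such a `c`). -/
def ballRadius (f : Affine.Triangle ℝ E3) (c : E3) : ℝ :=
  dist c (f.points 0)

/-- `c` is a centre `x_f` of the largest surface Delaunay ball `SDB(f)`: among the intersections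
of the dual Voronoi edge of `f` with `S`, it gives a ball of maximal radius. -/
def IsSurfaceBallCentre (S X : Set E3) (f : Affine.Triangle ℝ E3) (c : E3) : Prop :=
  c ∈ voronoiEdge X f ∩ S ∧ ∀ c' ∈ voronoiEdge X f ∩ S, ballRadius f c' ≤ ballRadius f c

/-- The size `h(f) = √3 r`, where `r` is the radius of the largest surface Delaunay ball of `f`,
which is centred at `c`. -/
def facetSize (f : Affine.Triangle ℝ E3) (c : E3) : ℝ :=
  Real.sqrt 3 * ballRadius f c

/-- The surface discretisation error `ε(f)`: the distance between the centre `c` of the largest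
surface Delaunay ball of `f` and the centre of the diametric ball of `f`. -/
def surfaceError (f : Affine.Triangle ℝ E3) (c : E3) : ℝ :=
  dist c f.circumcenter

/-! ### The algorithm -/

/-- The user-supplied data: the thresholds `ρ̄`, `h̄`, `ε̄`, and the coefficient `α` that scales
the size threshold. -/
structure Params where
  rhoBar : ℝ
  alpha : ℝ
  hBar : E3 → ℝ
  epsBar : E3 → ℝ

/-- The facet `f`, with `x_f = c`, violates one of the constraints on shape, size and surface
error. -/
def IsBad (P : Params) (f : Affine.Triangle ℝ E3) (c : E3) : Prop :=
  P.rhoBar ≤ radiusEdgeRatio f ∨ P.alpha * P.hBar c ≤ facetSize f c ∨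
    P.epsBar c ≤ surfaceError f c

/-- The queue of bad facets of `Del|_S(X)`. -/
def queue (P : Params) (S X : Set E3) : Set (Affine.Triangle ℝ E3) :=
  {f ∈ restrictedFacets S X | ∃ c, IsSurfaceBallCentre S X f c ∧ IsBad P f c}

/-- The target size `h̄_σ` for the triangle `σ` with base `[u, v]` and apex `x`: the mean of `h̄`
at the midpoints of the two new edges. -/
def targetSize (P : Params) (u v x : E3) : ℝ :=
  (P.hBar (midpoint ℝ u x) + P.hBar (midpoint ℝ v x)) / 2

/-- The altitude `a_σ` prescribed for the isosceles triangle `σ` with base `[u, v]`, apex `x`. -/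
def targetAltitude (P : Params) (u v x : E3) : ℝ :=
  min (Real.sqrt (targetSize P u v x ^ 2 - (dist u v / 2) ^ 2))
    (Real.sqrt 3 / 2 * targetSize P u v x)

/-- The candidates for the size-optimal (Type II) vertex over the frontal edge `[u, v]`: points of
the surface on the Voronoi face dual to `[u, v]`, whose distance to the midpoint of `[u, v]` is
the prescribed altitude. (The first inequality says that the radicand in the altitude is
non-negative, so that the altitude is defined.) -/
def typeTwoCandidates (P : Params) (S X : Set E3) (u v : E3) : Set E3 :=
  {x ∈ S ∩ voronoiFace X {u, v} | dist u v / 2 ≤ targetSize P u v x ∧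
    dist x (midpoint ℝ u v) = targetAltitude P u v x}

/-- `x` is a Type II vertex for the frontal edge `[u, v]`: a candidate that is best aligned with
the frontal direction, which points from the midpoint of `[u, v]` to the surface ball centre. -/
def IsTypeTwo (P : Params) (S X : Set E3) (u v c x : E3) : Prop :=
  x ∈ typeTwoCandidates P S X u v ∧ ∀ y ∈ typeTwoCandidates P S X u v,
    inner ℝ (y - midpoint ℝ u v) (c - midpoint ℝ u v) ≤
      inner ℝ (x - midpoint ℝ u v) (c - midpoint ℝ u v)

/-- The Type II vertex `x` is preferred to the Type I vertex `c`: with `m₀` the midpoint of the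
frontal edge `e₀ = [u, v]`, `d² ≤ d¹` and `d² ≥ ‖e₀‖ / 2`, where `d¹ = ‖c - m₀‖` and
`d² = ‖x - m₀‖`. -/
def TypeTwoAccepted (u v c x : E3) : Prop :=
  dist x (midpoint ℝ u v) ≤ dist c (midpoint ℝ u v) ∧
    dist u v / 2 ≤ dist x (midpoint ℝ u v)

/-- `p` is a refinement point of `f`, whose largest surface ball is centred at `c`: for a
frontal (that is, shortest) edge `[u, v]` of `f`, it is a Type II vertex if there is one that is
accepted, and the Type I vertex `c` otherwise. -/
def IsRefinementPoint (P : Params) (S X : Set E3) (f : Affine.Triangle ℝ E3) (c p : E3) : Prop :=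
  ∃ i j : Fin 3, i ≠ j ∧ dist (f.points i) (f.points j) = minEdge f ∧
    ((∃ x, IsTypeTwo P S X (f.points i) (f.points j) c x ∧
        ((TypeTwoAccepted (f.points i) (f.points j) c x ∧ p = x) ∨
          (¬ TypeTwoAccepted (f.points i) (f.points j) c x ∧ p = c))) ∨
      (typeTwoCandidates P S X (f.points i) (f.points j) = ∅ ∧ p = c))

/-- One refinement step of the Frontal-Delaunay algorithm: some bad facet of the current
restricted triangulation is taken from the queue, and its refinement point is inserted. -/
def Step (P : Params) (S X Y : Set E3) : Prop :=
  ∃ f ∈ restrictedFacets S X, ∃ c, IsSurfaceBallCentre S X f c ∧ IsBad P f c ∧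
    ∃ p, IsRefinementPoint P S X f c p ∧ Y = insert p X

/-- `X` occurs as the vertex set in some run of the algorithm started at the sample `X₀`. -/
def Reachable (P : Params) (S X₀ X : Set E3) : Prop :=
  Relation.ReflTransGen (Step P S) X₀ X

/-- `X` is the vertex set of an output: it is reached by a run that has come to a halt. -/
def IsOutput (P : Params) (S X₀ X : Set E3) : Prop :=
  Reachable P S X₀ X ∧ ¬ ∃ Y, Step P S X Y

end FrontalDelaunay

end

namespace FrontalDelaunay

variable {S X Y X₀ : Set E3} {P : Params} {f : Affine.Triangle ℝ E3} {c p u v x : E3}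

/-! Termination is a packing argument: a fixed `δ > 0` bounds from below the distance from each
inserted point to all earlier sites, and a compact set contains no infinite `δ`-separated sequence.
A Type I vertex `c` has the vertices of `f` as nearest sites, so its insertion distance is the ball
radius `r`. Since `r ^ 2 = ε(f) ^ 2 + R ^ 2`, each kind of badness bounds `r` below
(`le_ballRadius_of_isBad`). A Type II vertex has `u` and `v` as nearest sites, and the prescribed
altitude keeps it away from them (`le_dist_of_mem_typeTwoCandidates`). A halted run has no bad
facet, because compactness supplies a refinement point for any bad one (`exists_isRefinementPoint`).
-/

theorem isClosed_voronoiFace (X A : Set E3) : IsClosed (voronoiFace X A) := by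
  simp only [voronoiFace, Set.ofPred_forall]
  exact isClosed_biInter fun a _ => isClosed_biInter fun y _ =>
    isClosed_le (by fun_prop) (by fun_prop)

theorem exists_isSurfaceBallCentre (hS : IsCompact S) (hf : f ∈ restrictedFacets S X) :
    ∃ c, IsSurfaceBallCentre S X f c := by
  have hK : IsCompact (voronoiEdge X f ∩ S) := hS.inter_left (isClosed_voronoiFace _ _)
  obtain ⟨c, hc, hmax⟩ := hK.exists_isMaxOn (f := ballRadius f) hf.2
    (by unfold ballRadius; fun_prop)
  exact ⟨c, hc, fun c' hc' => hmax hc'⟩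

/-- Compactness yields a candidate best aligned with the frontal direction. `Real.sqrt` is
continuous also where the radicand is negative, so the altitude equation is a closed condition. -/
theorem isCompact_typeTwoCandidates (hS : IsCompact S) (hP : Continuous P.hBar) (X : Set E3)
    (u v : E3) : IsCompact (typeTwoCandidates P S X u v) := by
  have hm (w : E3) : Continuous fun x => P.hBar (midpoint ℝ w x) :=
    by
    have h : Continuous fun x => midpoint ℝ w x := by
      simp_rw [midpoint_eq_smul_add]
      fun_prop
    exact hP.comp h
  have ht : Continuous (targetSize P u v) := ((hm u).add (hm v)).div_const 2
  have ha : Continuous (targetAltitude P u v) := by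
    unfold targetAltitude
    fun_prop
  exact (hS.inter_right (isClosed_voronoiFace _ _)).inter_right
    ((isClosed_le continuous_const ht).inter (isClosed_eq (by fun_prop) ha))

theorem exists_dist_eq_minEdge (f : Affine.Triangle ℝ E3) :
    ∃ i j : Fin 3, i ≠ j ∧ dist (f.points i) (f.points j) = minEdge f := by
  unfold minEdge
  rcases min_choice (dist (f.points 0) (f.points 1))
    (min (dist (f.points 1) (f.points 2)) (dist (f.points 2) (f.points 0))) with h | h
  · exact ⟨0, 1, by decide, h.symm⟩
  · rcases min_choice (dist (f.points 1) (f.points 2)) (dist (f.points 2) (f.points 0))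
      with h' | h'
    · exact ⟨1, 2, by decide, by rw [h, h']⟩
    · exact ⟨2, 0, by decide, by rw [h, h']⟩

theorem exists_isRefinementPoint (hS : IsCompact S) (hP : Continuous P.hBar) (X : Set E3)
    (f : Affine.Triangle ℝ E3) (c : E3) : ∃ p, IsRefinementPoint P S X f c p := by
  obtain ⟨i, j, hij, hmin⟩ := exists_dist_eq_minEdge f
  rcases (typeTwoCandidates P S X (f.points i) (f.points j)).eq_empty_or_nonempty with he | hne
  · exact ⟨c, i, j, hij, hmin, Or.inr ⟨he, rfl⟩⟩
  · obtain ⟨x, hx, hmax⟩ := (isCompact_typeTwoCandidates hS hP X _ _).exists_isMaxOn hne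
      (f := fun y => inner ℝ (y - midpoint ℝ (f.points i) (f.points j))
        (c - midpoint ℝ (f.points i) (f.points j))) (by fun_prop)
    have hx2 : IsTypeTwo P S X (f.points i) (f.points j) c x := ⟨hx, fun y hy => hmax hy⟩
    by_cases hacc : TypeTwoAccepted (f.points i) (f.points j) c x
    · exact ⟨x, i, j, hij, hmin, Or.inl ⟨x, hx2, Or.inl ⟨hacc, rfl⟩⟩⟩
    · exact ⟨c, i, j, hij, hmin, Or.inl ⟨x, hx2, Or.inr ⟨hacc, rfl⟩⟩⟩

theorem dist_points_eq_ballRadius (hX : Set.range f.points ⊆ X) (hc : c ∈ voronoiEdge X f)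
    (i : Fin 3) : dist (f.points i) c = ballRadius f c := by
  rw [dist_comm]
  exact le_antisymm (hc _ ⟨i, rfl⟩ _ (hX ⟨0, rfl⟩)) (hc _ ⟨0, rfl⟩ _ (hX ⟨i, rfl⟩))

theorem ballRadius_le_dist (hc : c ∈ voronoiEdge X f) {y : E3} (hy : y ∈ X) :
    ballRadius f c ≤ dist c y :=
  hc _ ⟨0, rfl⟩ _ hy

/-- Pythagoras for the centre `c` of a ball circumscribing `f`. -/
theorem surfaceError_sq_add_circumradius_sq (hX : Set.range f.points ⊆ X)
    (hc : c ∈ voronoiEdge X f) :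
    surfaceError f c ^ 2 + f.circumradius ^ 2 = ballRadius f c ^ 2 := by
  have hr := dist_points_eq_ballRadius hX hc
  -- A point equidistant from the vertices projects orthogonally onto the circumcentre.
  have h := f.dist_circumcenter_sq_eq_sq_sub_circumradius hr
    (f.orthogonalProjection_eq_circumcenter_of_dist_eq hr) (mem_affineSpan ℝ ⟨0, rfl⟩)
  unfold surfaceError
  linarith

theorem circumradius_le_ballRadius (hX : Set.range f.points ⊆ X) (hc : c ∈ voronoiEdge X f) :
    f.circumradius ≤ ballRadius f c := by
  have hb : 0 ≤ ballRadius f c := dist_nonneg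
  refine (abs_le_of_sq_le_sq' ?_ hb).2
  linarith [surfaceError_sq_add_circumradius_sq hX hc, sq_nonneg (surfaceError f c)]

theorem surfaceError_le_ballRadius (hX : Set.range f.points ⊆ X) (hc : c ∈ voronoiEdge X f) :
    surfaceError f c ≤ ballRadius f c := by
  have hb : 0 ≤ ballRadius f c := dist_nonneg
  refine (abs_le_of_sq_le_sq' ?_ hb).2
  linarith [surfaceError_sq_add_circumradius_sq hX hc, sq_nonneg f.circumradius]

theorem le_minEdge {δ : ℝ} (hsep : X.Pairwise fun y z => δ ≤ dist y z)
    (hX : Set.range f.points ⊆ X) : δ ≤ minEdge f := by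
  have h (i j : Fin 3) (hij : i ≠ j) : δ ≤ dist (f.points i) (f.points j) :=
    hsep (hX ⟨i, rfl⟩) (hX ⟨j, rfl⟩) (f.independent.injective.ne hij)
  exact le_min (h 0 1 (by decide)) (le_min (h 1 2 (by decide)) (h 2 0 (by decide)))

/-- The ball of a bad facet is not small compared with the separation of the sites and the
thresholds. -/
theorem le_ballRadius_of_isBad {δ h₀ ε₀ : ℝ} (hδ : 0 < δ) (hrho : 1 ≤ P.rhoBar)
    (halpha : 0 < P.alpha) (hh : ∀ x, h₀ ≤ P.hBar x) (hε : ∀ x ∈ S, ε₀ ≤ P.epsBar x)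
    (hδh : Real.sqrt 3 * δ ≤ P.alpha * h₀) (hδε : δ ≤ ε₀)
    (hsep : X.Pairwise fun y z => δ ≤ dist y z) (hX : Set.range f.points ⊆ X)
    (hc : c ∈ voronoiEdge X f) (hcS : c ∈ S) (hbad : IsBad P f c) : δ ≤ ballRadius f c := by
  rcases hbad with h | h | h
  -- Here `ρ̄ ≥ 1` matters: `R ≥ ρ̄ * minEdge f ≥ minEdge f ≥ δ`, so the separation does not decay.
  · have hm := le_minEdge hsep hX
    have h1 := (le_div_iff₀ (hδ.trans_le hm)).1 (hrho.trans h)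
    linarith [circumradius_le_ballRadius hX hc]
  · have h1 := mul_le_mul_of_nonneg_left (hh c) halpha.le
    exact le_of_mul_le_mul_left (hδh.trans (h1.trans h)) (by positivity)
  · exact hδε.trans ((hε c hcS).trans (h.trans (surfaceError_le_ballRadius hX hc)))

/-- As `x` is equidistant from `u` and `v`, its squared distance to them is the squared altitude
plus `(dist u v / 2) ^ 2`. This equals `h̄_σ ^ 2` if the square root attains the minimum, and is at
least `3 / 4 * h̄_σ ^ 2` otherwise. -/
theorem le_dist_of_mem_typeTwoCandidates {h₀ : ℝ} (hh₀ : 0 < h₀) (hh : ∀ x, h₀ ≤ P.hBar x)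
    (hu : u ∈ X) (hv : v ∈ X) (hx : x ∈ typeTwoCandidates P S X u v) {y : E3} (hy : y ∈ X) :
    h₀ / 2 ≤ dist x y := by
  obtain ⟨⟨-, hxV⟩, hrad, halt⟩ := hx
  refine le_trans ?_ (hxV u (by simp) y hy)
  have huv : dist x u = dist x v :=
    le_antisymm (hxV u (by simp) v hv) (hxV v (by simp) u hu)
  have hpy := EuclideanGeometry.dist_sq_add_dist_sq_eq_two_mul_dist_midpoint_sq_add_half_dist_sq
    x u v
  rw [← huv, halt] at hpy
  have ht : h₀ ≤ targetSize P u v x := by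
    unfold targetSize
    linarith [hh (midpoint ℝ u x), hh (midpoint ℝ v x)]
  have hsq : (dist u v / 2) ^ 2 ≤ targetSize P u v x ^ 2 :=
    pow_le_pow_left₀ (by positivity) hrad 2
  refine (abs_le_of_sq_le_sq' ?_ dist_nonneg).2
  have h3 : Real.sqrt 3 ^ 2 = 3 := Real.sq_sqrt (by norm_num)
  have hh2 : h₀ ^ 2 ≤ targetSize P u v x ^ 2 := pow_le_pow_left₀ hh₀.le ht 2
  have he : 0 ≤ (dist u v / 2) ^ 2 := sq_nonneg _
  unfold targetAltitude at hpy
  rcases min_choice (Real.sqrt (targetSize P u v x ^ 2 - (dist u v / 2) ^ 2))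
    (Real.sqrt 3 / 2 * targetSize P u v x) with h | h
  · rw [h, Real.sq_sqrt (by linarith)] at hpy
    linarith
  · rw [h, mul_pow, div_pow, h3] at hpy
    linarith

/-- The inserted point keeps the separation of the sites. -/
theorem Step.exists_insert {δ h₀ ε₀ : ℝ} (hδ : 0 < δ) (hrho : 1 ≤ P.rhoBar)
    (halpha : 0 < P.alpha) (hh₀ : 0 < h₀) (hh : ∀ x, h₀ ≤ P.hBar x)
    (hε : ∀ x ∈ S, ε₀ ≤ P.epsBar x) (hδh : Real.sqrt 3 * δ ≤ P.alpha * h₀) (hδε : δ ≤ ε₀)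
    (hδ2 : δ ≤ h₀ / 2) (hsep : X.Pairwise fun y z => δ ≤ dist y z) (h : Step P S X Y) :
    ∃ p ∈ S, Y = insert p X ∧ ∀ y ∈ X, δ ≤ dist p y := by
  obtain ⟨f, ⟨⟨hX, -⟩, -⟩, c, ⟨⟨hc, hcS⟩, -⟩, hbad, p, ⟨i, j, -, -, hp⟩, rfl⟩ := h
  have hI (y) (hy : y ∈ X) : δ ≤ dist c y :=
    (le_ballRadius_of_isBad hδ hrho halpha hh hε hδh hδε hsep hX hc hcS hbad).trans
      (ballRadius_le_dist hc hy)
  rcases hp with ⟨x, ⟨hx, -⟩, ⟨-, rfl⟩ | ⟨-, rfl⟩⟩ | ⟨-, rfl⟩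
  · exact ⟨p, hx.1.1, rfl, fun y hy => hδ2.trans
      (le_dist_of_mem_typeTwoCandidates hh₀ hh (hX ⟨i, rfl⟩) (hX ⟨j, rfl⟩) hx hy)⟩
  · exact ⟨p, hcS, rfl, hI⟩
  · exact ⟨p, hcS, rfl, hI⟩

theorem pairwise_le_dist_insert {δ : ℝ} (hsep : X.Pairwise fun y z => δ ≤ dist y z)
    (hp : ∀ y ∈ X, δ ≤ dist p y) : (insert p X).Pairwise fun y z => δ ≤ dist y z :=
  hsep.insert fun y hy _ => ⟨hp y hy, dist_comm p y ▸ hp y hy⟩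

theorem exists_pos_pairwise_le_dist (hX : X.Finite) :
    ∃ δ > 0, X.Pairwise fun y z => δ ≤ dist y z := by
  by_cases hn : X.Nontrivial
  · exact ⟨X.infsep, hX.infsep_pos_iff_nontrivial.2 hn,
      fun y hy z hz hyz => Set.infsep_le_dist_of_mem hy hz hyz⟩
  · exact ⟨1, one_pos, (Set.not_nontrivial_iff.1 hn).pairwise _⟩

/-- A uniform lower bound on the insertion distances along all runs from `X₀`. -/
theorem exists_separation {h₀ ε₀ : ℝ} (hrho : 1 ≤ P.rhoBar) (halpha : 0 < P.alpha)
    (hh₀ : 0 < h₀) (hh : ∀ x, h₀ ≤ P.hBar x) (hε₀ : 0 < ε₀) (hε : ∀ x ∈ S, ε₀ ≤ P.epsBar x)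
    (hfin : X₀.Finite) :
    ∃ δ > 0, (X₀.Pairwise fun y z => δ ≤ dist y z) ∧
      ∀ X Y, (X.Pairwise fun y z => δ ≤ dist y z) → Step P S X Y →
        ∃ p ∈ S, Y = insert p X ∧ ∀ y ∈ X, δ ≤ dist p y := by
  obtain ⟨δ₀, hδ₀, hsep⟩ := exists_pos_pairwise_le_dist hfin
  have h3 : 0 < Real.sqrt 3 := by positivity
  -- The four terms serve the initial sample, badness in size, badness in surface error, and Type II
  -- vertices.
  refine ⟨min δ₀ (min (P.alpha * h₀ / Real.sqrt 3) (min ε₀ (h₀ / 2))), by positivity,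
    hsep.mono' fun y z h => (min_le_left _ _).trans h, fun X Y hX h => ?_⟩
  refine h.exists_insert (by positivity) hrho halpha hh₀ hh hε ?_ ?_ ?_ hX
  · rw [mul_comm, ← le_div_iff₀ h3]
    exact (min_le_right _ _).trans (min_le_left _ _)
  · exact (min_le_right _ _).trans ((min_le_right _ _).trans (min_le_left _ _))
  · exact (min_le_right _ _).trans ((min_le_right _ _).trans (min_le_right _ _))

/-- A convergent subsequence would be Cauchy, hence have two terms closer than `δ`. -/
theorem not_exists_seq_separated {S : Set E3} (hS : IsCompact S) {δ : ℝ} (hδ : 0 < δ) :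
    ¬ ∃ p : ℕ → E3, (∀ n, p n ∈ S) ∧ ∀ m n, m < n → δ ≤ dist (p n) (p m) := by
  rintro ⟨p, hpS, hp⟩
  obtain ⟨a, -, φ, hφ, hlim⟩ := hS.tendsto_subseq hpS
  obtain ⟨N, hN⟩ := Metric.cauchySeq_iff.1 hlim.cauchySeq δ hδ
  exact (hN (N + 1) (Nat.le_succ N) N le_rfl).not_ge (hp _ _ (hφ N.lt_succ_self))

/-- There is no infinite run if insertions are uniformly far from the existing sites of the
compact set `S`. -/
theorem not_exists_run {δ : ℝ} (hS : IsCompact S) (hδ : 0 < δ)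
    (h0 : X₀.Pairwise fun y z => δ ≤ dist y z)
    (hstep : ∀ X Y, (X.Pairwise fun y z => δ ≤ dist y z) → Step P S X Y →
      ∃ p ∈ S, Y = insert p X ∧ ∀ y ∈ X, δ ≤ dist p y) :
    ¬ ∃ X : ℕ → Set E3, X 0 = X₀ ∧ ∀ k, Step P S (X k) (X (k + 1)) := by
  rintro ⟨X, rfl, hX⟩
  have hsep (k) : (X k).Pairwise fun y z => δ ≤ dist y z := by
    induction k with
    | zero => exact h0
    | succ k ih =>
      obtain ⟨p, -, he, hp⟩ := hstep _ _ ih (hX k)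
      exact he ▸ pairwise_le_dist_insert ih hp
  choose p hpS he hp using fun k => hstep _ _ (hsep k) (hX k)
  have hmono : Monotone X :=
    monotone_nat_of_le_succ fun k => (he k) ▸ Set.subset_insert _ _
  -- For `m < n`, the point `p m` already lies in `X (m + 1) ⊆ X n` when `p n` is inserted.
  exact not_exists_seq_separated hS hδ ⟨p, hpS, fun m n hmn =>
    hp n _ (hmono (Nat.succ_le_of_lt hmn) ((he m) ▸ Set.mem_insert _ _))⟩

/-- A relation without infinite chains from `a` reaches a terminal element from `a`. -/
theorem exists_terminal_of_not_exists_chain {α : Type*} {r : α → α → Prop} {a : α}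
    (h : ¬ ∃ s : ℕ → α, s 0 = a ∧ ∀ k, r (s k) (s (k + 1))) :
    ∃ b, Relation.ReflTransGen r a b ∧ ¬ ∃ d, r b d := by
  by_contra! hc
  -- `g` is total, but a genuine successor only at reachable elements; its iterates from `a` remain
  -- reachable.
  choose! g hg using hc
  have hreach (k : ℕ) : Relation.ReflTransGen r a (g^[k] a) := by
    induction k with
    | zero => exact .refl
    | succ k ih =>
      rw [Function.iterate_succ_apply']
      exact ih.tail (hg _ ih)
  exact h ⟨fun k => g^[k] a, rfl, fun k => by
    simpa only [Function.iterate_succ_apply'] using hg _ (hreach k)⟩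

theorem Step.subset_and_finite (h : Step P S X Y) (hX : X ⊆ S) (hfin : X.Finite) :
    Y ⊆ S ∧ Y.Finite := by
  obtain ⟨f, -, c, ⟨⟨-, hcS⟩, -⟩, -, p, ⟨i, j, -, -, hp⟩, rfl⟩ := h
  refine ⟨Set.insert_subset ?_ hX, hfin.insert p⟩
  rcases hp with ⟨x, ⟨hx, -⟩, ⟨-, rfl⟩ | ⟨-, rfl⟩⟩ | ⟨-, rfl⟩
  exacts [hx.1.1, hcS, hcS]

theorem Reachable.subset_and_finite (h : Reachable P S X₀ X) (hX : X₀ ⊆ S) (hfin : X₀.Finite) :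
    X ⊆ S ∧ X.Finite := by
  induction h with
  | refl => exact ⟨hX, hfin⟩
  | tail _ hs ih => exact hs.subset_and_finite ih.1 ih.2

/-- The algorithm halts only with an empty queue. -/
theorem queue_eq_empty (hS : IsCompact S) (hP : Continuous P.hBar) (h : ¬ ∃ Y, Step P S X Y) :
    queue P S X = ∅ := by
  refine Set.eq_empty_of_forall_notMem fun f ⟨hf, c, hc, hbad⟩ => h ?_
  obtain ⟨p, hp⟩ := exists_isRefinementPoint hS hP X f c
  exact ⟨_, f, hf, c, hc, hbad, p, hp, rfl⟩

end FrontalDelaunay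

/-- The Frontal-Delaunay algorithm terminates (no run is infinite), it halts with an empty queue
of bad facets only, and all facets of its output satisfy the three bounds. -/
theorem corollary1
    (S : Set FrontalDelaunay.E3) (hS : FrontalDelaunay.IsSmoothClosedSurface S)
    (P : FrontalDelaunay.Params) (hrho : 1 ≤ P.rhoBar) (halpha : 0 < P.alpha)
    (hcont : Continuous P.hBar)
    (h₀ : ℝ) (hh₀ : 0 < h₀) (hh : ∀ x, h₀ ≤ P.hBar x)
    (ε₀ : ℝ) (hε₀ : 0 < ε₀) (hε : ∀ x ∈ S, ε₀ ≤ P.epsBar x)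
    (X₀ : Set FrontalDelaunay.E3) (hfin : X₀.Finite) (hX₀ : X₀ ⊆ S) :
    (¬ ∃ X : ℕ → Set FrontalDelaunay.E3,
        X 0 = X₀ ∧ ∀ k, FrontalDelaunay.Step P S (X k) (X (k + 1))) ∧
    (∃ X, FrontalDelaunay.IsOutput P S X₀ X) ∧
    (∀ X, FrontalDelaunay.IsOutput P S X₀ X →
      X.Finite ∧ X ⊆ S ∧ FrontalDelaunay.queue P S X = ∅ ∧
      ∀ f ∈ FrontalDelaunay.restrictedFacets S X,
        FrontalDelaunay.radiusEdgeRatio f < P.rhoBar ∧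
        (∃ c, FrontalDelaunay.IsSurfaceBallCentre S X f c) ∧
        ∀ c, FrontalDelaunay.IsSurfaceBallCentre S X f c →
          FrontalDelaunay.facetSize f c < P.alpha * P.hBar c ∧
          FrontalDelaunay.surfaceError f c < P.epsBar c) := by
  have hSc := hS.isCompact
  obtain ⟨δ, hδ, h0, hstep⟩ :=
    FrontalDelaunay.exists_separation hrho halpha hh₀ hh hε₀ hε hfin
  have hrun := FrontalDelaunay.not_exists_run hSc hδ h0 hstep
  refine ⟨hrun, FrontalDelaunay.exists_terminal_of_not_exists_chain hrun, fun X hX => ?_⟩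
  obtain ⟨hXS, hXfin⟩ := hX.1.subset_and_finite hX₀ hfin
  have hq := FrontalDelaunay.queue_eq_empty hSc hcont hX.2
  refine ⟨hXfin, hXS, hq, fun f hf => ?_⟩
  have hgood (c) (hc : FrontalDelaunay.IsSurfaceBallCentre S X f c) :
      ¬ FrontalDelaunay.IsBad P f c := fun hbad =>
    Set.notMem_empty f (hq ▸ ⟨hf, c, hc, hbad⟩)
  simp only [FrontalDelaunay.IsBad, not_or, not_le] at hgood
  -- The shape bound involves no centre, but badness is tested at one, so one must exist.
  obtain ⟨c, hc⟩ := FrontalDelaunay.exists_isSurfaceBallCentre hSc hf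
  exact ⟨(hgood c hc).1, ⟨c, hc⟩, fun c' hc' => (hgood c' hc').2⟩
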